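/- **Theorem (Strengthening).** Let $\Sigma$ be a PCM and let $LD$ be a PCM of loading data. Let $S,S',S_A$ be collections of function specifications over $\Sigma$, $A$ a pre-abstraction and $\sigma\in\Sigma$ (all of which may depend on the global loading data $L\in LD$), and let $ld\in LD$. If $S'\sqsupseteq S$ (for every $L$), then $$[S\rtimes(A,\sigma):S_A]\ \le_{\mathrm{ctx}}\ [S'\rtimes(A,\sigma):S_A],$$ where each abspec is regarded as the one-module program with loading data $ld$ and semantics the given abspec. The notions are as follows. *Values, trees, modules.* $\mathtt{Any}$ is the type of all values; $\uparrow\! x$ is $x$ seen as a value. $\mathrm{itree}\,E\,T$ is the type of (possibly infinite) interaction trees: a tree returns a value in $T$, makes a silent step, or triggers an event of $E$ with answer type $X$ and continues according to the answer. Module events are $\mathtt{Choose}(X)$, $\mathtt{Take}(X)$ (answer in $X$), $\mathtt{Obs}\,fn\,args$, $\mathtt{Call}\,fn\,args$, $\mathtt{Get}$ (answer in $\mathtt{Any}$), $\mathtt{Put}\,a$ (no answer), $\mathtt{GetCaller}$ (answer: a string). A module semantics is a triple (name, initial local state in $\mathtt{Any}$, finite partial map from function names to functions $\mathtt{Any}\to\mathrm{itree}$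 over module events). A pre-abstraction is the same, except that each function has two semantics ($frd$ for friends, $ctx$ for contexts) which may also trigger the event $\mathtt{IPC}$ (no answer). $\mathbf{assume}(p)$ takes and $\mathbf{guarantee}(p)$ chooses a proof of $p$. UB is a take from $\emptyset$ and NB a choice from $\emptyset$. *Specifications.* A PCM is a commutative monoid $(M,+,\varepsilon)$ with a predicate $\mathcal V$ such that $\mathcal V(\varepsilon)$, and $\mathcal V(x+y)$ implies $\mathcal V(x)$. For predicates on $\Sigma$, $P\vdash Q$ means that $P(x)$ implies $Q(x)$ for every $x$ with $\mathcal V(x)$, and $(\mathsf{upd}\,P)(x)$ means that for every $c$ with $\mathcal V(x+c)$ there is $y$ with $\mathcal V(y+c)$ and $P(y)$. A measure is an element of $\mathtt{option}\,\mathtt{ord}$; $\mathtt{Some}\,o\sqsubset\mathtt{Some}\,o'$ iff $o<o'$, $d\sqsubset\mathtt{None}$ always, and $\mathtt{None}\not\sqsubset\mathtt{Some}\,o$. A specification consists of a type $\mathtt A$ and, for each $a\in\mathtt A$, a precondition $P_a(x,x_a,d)$ and a postcondition $Q_a(r,r_a)$, both predicates on $\Sigma$ ($x,x_a,r,r_a\in\mathtt{Any}$,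 $d$ a measure). A collection of specifications is a finite partial map from function names to specifications. $s_*$ is the specification with $\mathtt A=()$, precondition $d=\mathtt{None}\wedge x=x_a$ and postcondition $r=r_a$. For specifications, $s_1\sqsupseteq s_0$ means: for every $a_0\in s_0.\mathtt A$ there is $a_1\in s_1.\mathtt A$ such that $P^0_{a_0}(x,x_a,d)\vdash\mathsf{upd}\,P^1_{a_1}(x,x_a,d)$ for all $x,x_a,d$, and $Q^1_{a_1}(r,r_a)\vdash\mathsf{upd}\,Q^0_{a_0}(r,r_a)$ for all $r,r_a$. For collections, $S_1\sqsupseteq S_0$ means: whenever $S_0(fn)=s_0$ is defined, $S_1(fn)=s_1$ is defined and $s_1\sqsupseteq s_0$. *Abspecs.* $[S\rtimes(A,\sigma):S_A]$ is the module semantics with name $A.\mathrm{name}$, initial state $(A.\mathrm{init},\uparrow\!\sigma)$, and, for every $fn$ on which both $A.\mathrm{funs}$ and $S_A$ are defined, the function which on $x$ takes a boolean and runs $\mathrm{Fun}(S,S_A(fn),frd)(x)$ if it is true and $\mathrm{Fun}(S,s_*,ctx)(x)$ otherwise. Here the local state is always of the form $(st,\uparrow\! m)$, and: - $\mathrm{ASSUME}(P,x,f)$: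 take $(x_a,d,\rho,\phi)$ with $\rho,\phi\in\Sigma$; read $m$; assume $P(x,x_a,d)(\rho)$; assume $\mathcal V(\rho+f+m+\phi)$; return $(x_a,d,\phi)$. - $\mathrm{GUARANTEE}(P,x_a,\phi)$: choose $(x,d,\rho,f,m')$ with $\rho,f,m'\in\Sigma$; guarantee $P(x,x_a,d)(\rho)$; guarantee $\mathcal V(\rho+f+m'+\phi)$; set $m:=m'$; return $(x,d,f)$. In both, a postcondition is used as a condition that ignores $d$. - $\mathrm{Fun}(S,s,g)(x)$: take $a\in s.\mathtt A$; $(x_a,d,\phi):=\mathrm{ASSUME}(P_a,x,\varepsilon)$; if $d=\mathtt{None}$, run $g(x_a)$ from frame $\phi$ with its events replaced as below, obtaining $r_a$ and a new frame $\phi$; if $d=\mathtt{Some}\,o$, run $\mathrm{IPC}(S,d,\phi)$, obtaining a new $\phi$, and choose $r_a\in\mathtt{Any}$; finally $(r,\_,\_):=\mathrm{GUARANTEE}(Q_a,r_a,\phi)$ and return $r$. - Inside $g(x_a)$ the current frame $\phi$ is threaded through; $\mathtt{Call}\,fn\,x_a$ becomes $\mathrm{Call}(S,d,\phi,fn,x_a)$,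 $\mathtt{IPC}$ becomes $\mathrm{IPC}(S,d,\phi)$, $\mathtt{Get}$ and $\mathtt{Put}$ act on the component $st$, and the other events are unchanged. - $\mathrm{Call}(S,d,\phi,fn,x_a)$: NB if $S(fn)$ is undefined; otherwise, with $S(fn)=(\mathtt A,P,Q)$, choose $a\in\mathtt A$; $(x,d',f):=\mathrm{GUARANTEE}(P_a,x_a,\phi)$; guarantee $d'\sqsubset d$; $r:=$ call $fn$ with $x$; $(r_a,\_,\phi'):=\mathrm{ASSUME}(Q_a,r,f)$; return $r_a$ and the new frame $\phi'$. - $\mathrm{IPC}(S,d,\phi)$: choose an ordinal $i$; while a chosen boolean is true, choose $(fn,x_a)$, run $\mathrm{Call}(S,d,\phi,fn,x_a)$, updating $\phi$, and replace $i$ by a chosen ordinal $i'<i$; return the last $\phi$. *Behaviours and refinement.* A module code is a pair of loading data in $LD$ and a function from $LD$ to module semantics; a program is a list of module codes, and linking $\circ$ is list concatenation. A program is loaded by adding up all loading data and giving the sum to every module; if the sum is not valid, or two modules have the same name or define the same function, its behaviour is UB. Otherwise it is executed from a given entry point (function name, argument, and name seen as caller): $\mathtt{Call}\,fn\,args$ runs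 the function $fn$ of the module that defines it (UB if there is none), which sees the calling module's name through $\mathtt{GetCaller}$, and $\mathtt{Get},\mathtt{Put}$ access the local state of the running module. A trace is an infinite sequence of observable events $(\mathtt{Obs}\,fn\,args,r)$, or a finite one ended by $\mathrm{Term}\,v$, Diverge, Error or Partial. $\mathrm{Beh}$ of a program is the set of its traces, defined coinductively: $\mathtt{Obs}$ may receive any answer; Partial is possible at any point; $\mathtt{Choose}$ is union and $\mathtt{Take}$ intersection over all continuations (so UB has all traces, and NB only the immediate Partial); Diverge is an infinite execution without observable events, for some answers to the choices and all answers to the takes. $M_i\le_{\mathrm{ctx}}M_a$ means $\mathrm{Beh}(C\circ M_i)\subseteq\mathrm{Beh}(C\circ M_a)$ for every program $C$ and every entry point. -/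

import Mathlib

universe u v r s t a b

noncomputable section

namespace AL

/-! ## Interaction trees -/

/-- The labels of the nodes of an interaction tree.  An event signature is a `PFunctor`: `E.A` is the
type of events and `E.B e` is the type of answers to the event `e`, so that the set `E(X)` of events
with answers in `X` is `{e // E.B e = X}`. -/
inductive ITreeShape (E : PFunctor.{a, b}) (R : Type r) : Type (max a r)
  | ret (x : R)
  | tau
  | vis (e : E.A)

/-- The polynomial functor `X ↦ R + X + Σ e, (E.B e → X)`. -/
abbrev ITreeF (E : PFunctor.{a, b}) (R : Type r) : PFunctor.{max a r, b} where
  A := ITreeShape E R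
  B
    | .ret _ => PEmpty.{b + 1}
    | .tau => PUnit.{b + 1}
    | .vis e => E.B e

/-- Interaction trees `itree E R`: the final coalgebra of `X ↦ R + X + Σ e, (E.B e → X)`. -/
def ITree (E : PFunctor.{a, b}) (R : Type r) : Type (max a b r) := (ITreeF E R).M

/-- One layer of an interaction tree with subtrees in `X`. -/
inductive View (E : PFunctor.{a, b}) (R : Type r) (X : Type s) : Type (max a b r s)
  | ret (x : R)
  | tau (t : X)
  | vis (e : E.A) (k : E.B e → X)

namespace View

variable {E : PFunctor.{a, b}} {R : Type r} {X : Type s} {Y : Type t}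

def map (f : X → Y) : View E R X → View E R Y
  | .ret x => .ret x
  | .tau t => .tau (f t)
  | .vis e k => .vis e fun y => f (k y)

def toObj : View E R X → (ITreeF E R).Obj X
  | .ret x => ⟨.ret x, PEmpty.elim⟩
  | .tau t => ⟨.tau, fun _ => t⟩
  | .vis e k => ⟨.vis e, k⟩

def ofObj : (ITreeF E R).Obj X → View E R X
  | ⟨.ret x, _⟩ => .ret x
  | ⟨.tau, k⟩ => .tau (k PUnit.unit)
  | ⟨.vis e, k⟩ => .vis e k

end View

namespace ITree

variable {E : PFunctor.{a, b}} {F : PFunctor.{s, b}} {R : Type r} {S : Type t}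

/-- The outermost layer of a tree. -/
def observe (x : ITree E R) : View E R (ITree E R) := View.ofObj (PFunctor.M.dest x)

/-- Corecursion. -/
def unfold {X : Type s} (f : X → View E R X) (x : X) : ITree E R :=
  PFunctor.M.corec (fun y => (f y).toObj) x

def ret (x : R) : ITree E R := PFunctor.M.mk (View.ret x).toObj

def tau (t : ITree E R) : ITree E R := PFunctor.M.mk (View.tau t).toObj

def vis (e : E.A) (k : E.B e → ITree E R) : ITree E R := PFunctor.M.mk (View.vis e k).toObj

/-- Trigger an event and return the answer. -/
def trigger (e : E.A) : ITree E (E.B e) := vis e ret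

/-- Sequential composition.  The corecursion state is either what remains of the first tree or what
remains of the continuation. -/
def bind (x : ITree E R) (k : R → ITree E S) : ITree E S :=
  unfold (X := ITree E R ⊕ ITree E S)
    (fun
      | .inl y =>
        match y.observe with
        | .ret z => (k z).observe.map .inr
        | .tau y' => .tau (.inl y')
        | .vis e k' => .vis e fun z => .inl (k' z)
      | .inr y => y.observe.map .inr)
    (.inl x)

instance : Monad (ITree E : Type r → Type (max a b r)) where
  pure := ret
  bind := bind

/-- Iteration: run `body`, start over on `inl i`, stop on `inr x`. -/
def iter {I : Type s} (body : I → ITree E (I ⊕ R)) (i : I) : ITree E R :=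
  unfold (X := ITree E (I ⊕ R))
    (fun y =>
      match y.observe with
      | .ret (.inl j) => .tau (body j)
      | .ret (.inr x) => .ret x
      | .tau y' => .tau y'
      | .vis e k => .vis e k)
    (body i)

/-- The interpretation function with states in `S`: every event `e` is replaced by the tree `h e s`,
which returns an answer and a new state. -/
def interp (h : (e : E.A) → S → ITree F (E.B e × S)) (x : ITree E R) (st : S) : ITree F (R × S) :=
  iter (I := ITree E R × S)
    (fun p =>
      match p.1.observe with
      | .ret y => ret (.inr (y, p.2))
      | .tau y => ret (.inl (y, p.2))
      | .vis e k => bind (h e p.2) fun q => ret (.inl (k q.1, q.2)))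
    (x, st)

end ITree

/-! ## Values and finite partial maps -/

/-- The type of all values: every value of every type (of the universe at hand) is injected by `up`,
and pairs of values are values. -/
inductive Any : Type (u + 1)
  | up (T : Type u) (x : T)
  | pair (x y : Any)

open Classical in
/-- Downcast to the type `T`. -/
def Any.down (T : Type u) : Any.{u} → Option T
  | .up T' x => if h : T' = T then some (cast h x) else none
  | .pair _ _ => none

/-- Finite partial maps from strings. -/
structure FinPMap (α : Type a) : Type a where
  get : String → Option α
  finite : {n | get n ≠ none}.Finite

/-- Combine two finite partial maps on the intersection of their domains. -/
def FinPMap.zipWith {α : Type a} {β : Type b} {γ : Type s} (f : α → β → γ)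
    (m : FinPMap α) (m' : FinPMap β) : FinPMap γ where
  get n :=
    match m.get n, m'.get n with
    | some x, some y => some (f x y)
    | _, _ => none
  finite := by
    refine m.finite.subset fun n hn h => hn ?_
    simp only [h]

/-! ## Events and modules -/

/-- Events of modules.  The first three are the primitive ones. -/
inductive EMSEvent : Type (u + 2)
  | choose (X : Type (u + 1))
  | take (X : Type (u + 1))
  | obs (fn : String) (args : Any.{u})
  | call (fn : String) (args : Any.{u})
  | get
  | put (x : Any.{u})
  | getCaller

/-- The event signature of modules. -/
abbrev EEMS : PFunctor.{u + 2, u + 1} where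
  A := EMSEvent.{u}
  B
    | .choose X => X
    | .take X => X
    | .obs _ _ => Any.{u}
    | .call _ _ => Any.{u}
    | .get => Any.{u}
    | .put _ => PUnit.{u + 2}
    | .getCaller => ULift.{u + 1} String

/-- Events of pre-abstractions: those of modules and implicit pure calls. -/
inductive PAbsEvent : Type (u + 2)
  | ems (e : EMSEvent.{u})
  | ipc

/-- The event signature of pre-abstractions. -/
abbrev EPAbs : PFunctor.{u + 2, u + 1} where
  A := PAbsEvent.{u}
  B
    | .ems e => EEMS.{u}.B e
    | .ipc => PUnit.{u + 2}

/-- Semantics of a function. -/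
abbrev Fundef (E : PFunctor.{u + 2, u + 1}) : Type (u + 2) := Any.{u} → ITree E Any.{u}

/-- Executable module semantics: module name, initial module-local state, functions. -/
structure EMS : Type (u + 2) where
  name : String
  init : Any.{u}
  funs : FinPMap (Fundef EEMS.{u})

/-- Pre-abstractions: each function has a semantics for friends and one for contexts. -/
structure PAbs : Type (u + 2) where
  name : String
  init : Any.{u}
  funs : FinPMap (Fundef EPAbs.{u} × Fundef EPAbs.{u})

/-! ## Resources and specifications -/

/-- Partial commutative monoids, with a validity predicate. -/
class PCM (M : Type a) extends AddCommMonoid M where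
  valid : M → Prop
  valid_zero : valid 0
  valid_of_add : ∀ x y : M, valid (x + y) → valid x

/-- Resource propositions. -/
abbrev RProp (M : Type a) : Type a := M → Prop

namespace RProp

variable {M : Type a} [PCM M]

/-- Entailment: inclusion on valid resources. -/
def Entails (P Q : RProp M) : Prop := ∀ x, PCM.valid x → P x → Q x

/-- The update modality. -/
def upd (P : RProp M) : RProp M :=
  fun x => ∀ c, PCM.valid (x + c) → ∃ y, PCM.valid (y + c) ∧ P y

/-- The lifting of a plain proposition. -/
def lift (p : Prop) : RProp M := fun _ => p

end RProp

/-- Measures: an ordinal for a pure call, `none` for an impure one. -/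
abbrev Measure : Type (u + 1) := Option Ordinal.{u}

/-- The relation `d ⊏ d'` on measures. -/
def Measure.lt : Measure.{u} → Measure.{u} → Prop
  | _, none => True
  | some o, some o' => o < o'
  | none, some _ => False

/-- Function specifications: a type `A` of logical variables, a precondition on concrete argument,
abstract argument and measure, a postcondition on concrete and abstract return value. -/
structure Spec (M : Type u) : Type (u + 2) where
  A : Type (u + 1)
  pre : A → Any.{u} → Any.{u} → Measure.{u} → RProp M
  post : A → Any.{u} → Any.{u} → RProp M

/-- Collections of specifications. -/
abbrev Specs (M : Type u) : Type (u + 2) := FinPMap (Spec M)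

/-- The specification that every function satisfies. -/
def Spec.star (M : Type u) : Spec M where
  A := PUnit
  pre _ x xa d := RProp.lift (d = none ∧ x = xa)
  post _ x xa := RProp.lift (x = xa)

/-- `s₁ ⊒ s₀`. -/
def Spec.Stronger {M : Type u} [PCM M] (s₁ s₀ : Spec M) : Prop :=
  ∀ a₀ : s₀.A, ∃ a₁ : s₁.A,
    (∀ x xa d, RProp.Entails (s₀.pre a₀ x xa d) (RProp.upd (s₁.pre a₁ x xa d))) ∧
    (∀ x xa, RProp.Entails (s₁.post a₁ x xa) (RProp.upd (s₀.post a₀ x xa)))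

/-- `S₁ ⊒ S₀`. -/
def Specs.Stronger {M : Type u} [PCM M] (S₁ S₀ : Specs M) : Prop :=
  ∀ fn s₀, S₀.get fn = some s₀ → ∃ s₁, S₁.get fn = some s₁ ∧ s₁.Stronger s₀

/-! ## The embedding of abspecs into module semantics -/

/-- Programs over the module events. -/
abbrev Prog (R : Type (u + 1)) : Type (u + 2) := ITree EEMS.{u} R

namespace Prog

def choose (X : Type (u + 1)) : Prog X := ITree.trigger (E := EEMS.{u}) (.choose X)

def take (X : Type (u + 1)) : Prog X := ITree.trigger (E := EEMS.{u}) (.take X)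

def call (fn : String) (x : Any.{u}) : Prog Any.{u} := ITree.trigger (E := EEMS.{u}) (.call fn x)

def get : Prog Any.{u} := ITree.trigger (E := EEMS.{u}) .get

def put (x : Any.{u}) : Prog PUnit.{u + 2} := ITree.trigger (E := EEMS.{u}) (.put x)

/-- Undefined behaviour: taking from the empty set. -/
def ub {R : Type (u + 1)} : Prog.{u} R := ITree.bind (take PEmpty.{u + 2}) fun x => x.elim

/-- No behaviour: choosing from the empty set. -/
def nb {R : Type (u + 1)} : Prog.{u} R := ITree.bind (choose PEmpty.{u + 2}) fun x => x.elim

/-- `assume(p)`: taking a proof of `p`. -/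
def assume (p : Prop) : Prog.{u} PUnit.{u + 2} := do
  let _ ← take (ULift.{u + 1} (PLift p))
  pure PUnit.unit

/-- `guarantee(p)`: choosing a proof of `p`. -/
def guarantee (p : Prop) : Prog.{u} PUnit.{u + 2} := do
  let _ ← choose (ULift.{u + 1} (PLift p))
  pure PUnit.unit

end Prog

section Abspec

variable {M : Type u} [PCM M]

/-- Read the local state of an abspec module, which is always a pair of the local state of the
pre-abstraction and the module-local resource. -/
def getPair (M : Type u) : Prog.{u} (Any.{u} × M) := do
  let x ← Prog.get
  match x with
  | .pair st y =>
    match y.down M with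
    | some m => pure (st, m)
    | none => Prog.ub
  | .up _ _ => Prog.ub

/-- Write the local state of an abspec module. -/
def putPair (st : Any.{u}) (m : M) : Prog.{u} PUnit.{u + 2} := Prog.put (.pair st (.up M m))

/-- `ASSUME(Cond, x, resf)`, returning the abstract value, the measure and the frame resource. -/
def ASSUME (Cond : Any.{u} → Any.{u} → Measure.{u} → RProp M) (x : Any.{u}) (resf : M) :
    Prog.{u} (Any.{u} × Measure.{u} × M) := do
  let (xa, d, res, frm) ← Prog.take (Any.{u} × Measure.{u} × M × M)
  let (_, resm) ← getPair M
  Prog.assume (Cond x xa d res)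
  Prog.assume (PCM.valid (res + resf + resm + frm))
  pure (xa, d, frm)

/-- `GUARANTEE(Cond, xa, frm)`, returning the concrete value, the measure and the function-local
resource. -/
def GUARANTEE (Cond : Any.{u} → Any.{u} → Measure.{u} → RProp M) (xa : Any.{u}) (frm : M) :
    Prog.{u} (Any.{u} × Measure.{u} × M) := do
  let (x, d, res, resf, resm) ← Prog.choose (Any.{u} × Measure.{u} × M × M × M)
  Prog.guarantee (Cond x xa d res)
  Prog.guarantee (PCM.valid (res + resf + resm + frm))
  let (st, _) ← getPair M
  putPair st resm
  pure (x, d, resf)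

/-- A call inside an abspec.  Calling a function without specification has no behaviour. -/
def abspecCall (S : Specs M) (d : Measure.{u}) (frm : M) (fn : String) (xa : Any.{u}) :
    Prog.{u} (Any.{u} × M) :=
  match S.get fn with
  | none => Prog.nb
  | some s => do
    let c ← Prog.choose s.A
    let (x, d', resf) ← GUARANTEE (s.pre c) xa frm
    Prog.guarantee (Measure.lt d' d)
    let y ← Prog.call fn x
    let (ya, _, frm') ← ASSUME (fun y ya _ => s.post c y ya) y resf
    pure (ya, frm')

/-- An implicit pure call: a nondeterministic but finite number of arbitrary calls; the loop
variables are the ordinal that bounds the remaining iterations and the frame resource. -/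
def abspecIPC (S : Specs M) (d : Measure.{u}) (frm : M) : Prog.{u} (PUnit.{u + 2} × M) := do
  let i ← Prog.choose Ordinal.{u}
  ITree.iter (I := Ordinal.{u} × M)
    (fun (i, frm) => do
      let go ← Prog.choose (ULift.{u + 1} Bool)
      if go.down then
        let (fn, xa) ← Prog.choose (String × Any.{u})
        let (_, frm') ← abspecCall S d frm fn xa
        let i' ← Prog.choose {i' : Ordinal.{u} // i' < i}
        pure (Sum.inl (i'.1, frm'))
      else
        pure (Sum.inr (PUnit.unit, frm)))
    (i, frm)

/-- Interpretation of the events of a pre-abstraction: calls and implicit pure calls are made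
according to the specifications, reading and writing of the local state concerns the first component
of the state, and the other events are kept. -/
def abspecHandler (S : Specs M) (d : Measure.{u}) :
    (e : EPAbs.{u}.A) → M → ITree EEMS.{u} (EPAbs.{u}.B e × M)
  | .ems (.call fn xa), frm => abspecCall S d frm fn xa
  | .ipc, frm => abspecIPC S d frm
  | .ems .get, frm => ITree.bind (getPair M) fun p => ITree.ret (p.1, frm)
  | .ems (.put st), frm =>
    ITree.bind (getPair M) fun p => ITree.bind (putPair st p.2) fun x => ITree.ret (x, frm)
  | .ems (.choose X), frm =>
    ITree.bind (ITree.trigger (E := EEMS.{u}) (.choose X)) fun x => ITree.ret (x, frm)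
  | .ems (.take X), frm =>
    ITree.bind (ITree.trigger (E := EEMS.{u}) (.take X)) fun x => ITree.ret (x, frm)
  | .ems (.obs fn args), frm =>
    ITree.bind (ITree.trigger (E := EEMS.{u}) (.obs fn args)) fun x => ITree.ret (x, frm)
  | .ems .getCaller, frm =>
    ITree.bind (ITree.trigger (E := EEMS.{u}) .getCaller) fun x => ITree.ret (x, frm)

def abspecBody (S : Specs M) (d : Measure.{u}) (frm : M) (body : ITree EPAbs.{u} Any.{u}) :
    Prog.{u} (Any.{u} × M) :=
  ITree.interp (abspecHandler S d) body frm

def abspecFun (S : Specs M) (s : Spec M) (f : Fundef EPAbs.{u}) : Fundef EEMS.{u} := fun x => do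
  let c ← Prog.take s.A
  let (xa, d, frm) ← ASSUME (s.pre c) x 0
  let (ya, frm') ←
    match d with
    | none => abspecBody S d frm (f xa)
    | some _ => do
      let (_, frm') ← abspecIPC S d frm
      let ya ← Prog.choose Any.{u}
      pure (ya, frm')
  let (y, _, _) ← GUARANTEE (fun y ya _ => s.post c y ya) ya frm'
  pure y

def toAbspec (S : Specs M) (f : Fundef EPAbs.{u} × Fundef EPAbs.{u}) (s : Spec M) :
    Fundef EEMS.{u} := fun x => do
  let isFriend ← Prog.take (ULift.{u + 1} Bool)
  if isFriend.down then abspecFun S s f.1 x else abspecFun S (Spec.star M) f.2 x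

/-- The abspec `[S ⋊ (A, σ) : S_A]`. -/
def abspec (S : Specs M) (A : PAbs.{u}) (σ : M) (SA : Specs M) : EMS.{u} where
  name := A.name
  init := .pair A.init (.up M σ)
  funs := A.funs.zipWith (toAbspec S) SA

end Abspec

/-! ## Execution of linked modules -/

/-- Module codes: loading data, and the module semantics depending on the global loading data. -/
structure Mod (LD : Type v) : Type (max v (u + 2)) where
  ld : LD
  sem : LD → EMS.{u}

/-- Linking is concatenation. -/
abbrev Mods (LD : Type v) : Type (max v (u + 2)) := List (Mod.{u} LD)

/-- The module semantics obtained by loading: all loading data are combined and given to each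
module. -/
def load {LD : Type v} [PCM LD] (Ms : Mods.{u} LD) : List EMS.{u} :=
  Ms.map fun m => m.sem (Ms.map Mod.ld).sum

/-- Loaded modules can be executed together if module names are distinct and no function is defined
twice. -/
def Linkable (Es : List EMS.{u}) : Prop :=
  Es.Pairwise fun m m' => m.name ≠ m'.name ∧ ∀ fn, m.funs.get fn = none ∨ m'.funs.get fn = none

/-- Find the module that defines a function, and the function. -/
def lookup (Es : List EMS.{u}) (fn : String) : Option (String × Fundef EEMS.{u}) :=
  Es.findSome? fun m => (m.funs.get fn).map fun f => (m.name, f)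

/-- Initial local states, by module name. -/
def initMem (Es : List EMS.{u}) (mn : String) : Any.{u} :=
  match Es.find? (fun m => m.name == mn) with
  | some m => m.init
  | none => .up PUnit PUnit.unit

/-- A suspended function: its module, the module of its caller, and what remains to be done once
the pending call has returned. -/
structure Frame : Type (u + 2) where
  mn : String
  caller : String
  k : Any.{u} → Prog.{u} Any.{u}

/-- Machine states: the running function (its module, the module of its caller, and what remains of
its body), the stack of suspended functions, and the local states of all modules. -/
structure Config : Type (u + 2) where
  mn : String
  caller : String
  cur : Prog.{u} Any.{u}
  stack : List Frame.{u}
  mem : String → Any.{u}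

/-- What a machine state does next. -/
inductive Next : Type (u + 2)
  | final (x : Any.{u})
  | choose (X : Type (u + 1)) (k : X → Config.{u})
  | take (X : Type (u + 1)) (k : X → Config.{u})
  | obs (fn : String) (args : Any.{u}) (k : Any.{u} → Config.{u})

/-- A silent step. -/
def Next.silent (c : Config.{u}) : Next.{u} := .choose PUnit fun _ => c

/-- The step function.  Calling an undefined function is undefined behaviour. -/
def Config.next (Es : List EMS.{u}) (c : Config.{u}) : Next.{u} :=
  match c.cur.observe with
  | .ret x =>
    match c.stack with
    | [] => .final x
    | f :: fs => .silent { c with mn := f.mn, caller := f.caller, cur := f.k x, stack := fs }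
  | .tau y => .silent { c with cur := y }
  | .vis (.choose X) k => .choose X fun x => { c with cur := k x }
  | .vis (.take X) k => .take X fun x => { c with cur := k x }
  | .vis (.obs fn args) k => .obs fn args fun x => { c with cur := k x }
  | .vis (.call fn args) k =>
    match lookup Es fn with
    | none => .take PEmpty fun x => x.elim
    | some (mn, f) =>
      .silent { mn := mn, caller := c.mn, cur := f args, stack := ⟨c.mn, c.caller, k⟩ :: c.stack,
                mem := c.mem }
  | .vis .get k => .silent { c with cur := k (c.mem c.mn) }
  | .vis (.put x) k =>
    .silent { c with cur := k PUnit.unit, mem := Function.update c.mem c.mn x }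
  | .vis .getCaller k => .silent { c with cur := k ⟨c.caller⟩ }

/-! ## Traces, behaviours, contextual refinement -/

/-- Observable events: an observable call and the answer of the environment. -/
structure ObsEvent : Type (u + 1) where
  fn : String
  args : Any.{u}
  answer : Any.{u}

/-- How a trace may end. -/
inductive TraceEnd : Type (u + 1)
  | term (x : Any.{u})
  | diverge
  | error
  | partialEnd

/-- Traces: finite sequences of observable events with one of the four ends, or infinite sequences
of observable events. -/
inductive Trace : Type (u + 1)
  | fin (l : List ObsEvent.{u}) (e : TraceEnd.{u})
  | inf (l : Stream' ObsEvent.{u})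

def Trace.cons (e : ObsEvent.{u}) : Trace.{u} → Trace.{u}
  | .fin l x => .fin (e :: l) x
  | .inf l => .inf (Stream'.cons e l)

/-- Silent divergence, the largest predicate with the property below: an infinite execution without
observable events, for some choices and all takes. -/
def Diverges (Es : List EMS.{u}) (c : Config.{u}) : Prop :=
  ∃ D : Config.{u} → Prop, D c ∧ ∀ c, D c →
    match c.next Es with
    | .final _ => False
    | .choose _ k => ∃ x, D (k x)
    | .take _ k => ∀ x, D (k x)
    | .obs _ _ _ => False

/-- The traces of a machine state up to the next observable event, after which the traces are given
by `R`.  Choices are interpreted by union, takes by intersection. -/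
inductive BehStep (Es : List EMS.{u}) (R : Config.{u} → Trace.{u} → Prop) :
    Config.{u} → Trace.{u} → Prop
  | term {c : Config.{u}} {x : Any.{u}} (h : c.next Es = .final x) :
      BehStep Es R c (.fin [] (.term x))
  | diverge {c : Config.{u}} (h : Diverges Es c) : BehStep Es R c (.fin [] .diverge)
  | stopped {c : Config.{u}} : BehStep Es R c (.fin [] .partialEnd)
  | obs {c : Config.{u}} {fn : String} {args : Any.{u}} {k : Any.{u} → Config.{u}}
      (h : c.next Es = .obs fn args k) (x : Any.{u}) {tr : Trace.{u}} (htr : R (k x) tr) :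
      BehStep Es R c (.cons ⟨fn, args, x⟩ tr)
  | choose {c : Config.{u}} {X : Type (u + 1)} {k : X → Config.{u}}
      (h : c.next Es = .choose X k) (x : X) {tr : Trace.{u}} (htr : BehStep Es R (k x) tr) :
      BehStep Es R c tr
  | take {c : Config.{u}} {X : Type (u + 1)} {k : X → Config.{u}}
      (h : c.next Es = .take X k) {tr : Trace.{u}} (htr : ∀ x, BehStep Es R (k x) tr) :
      BehStep Es R c tr

/-- The traces of a machine state: the largest relation `R` with `R ⊆ BehStep R`. -/
def Config.Beh (Es : List EMS.{u}) (c : Config.{u}) (tr : Trace.{u}) : Prop :=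
  ∃ R : Config.{u} → Trace.{u} → Prop, R c tr ∧ ∀ c tr, R c tr → BehStep Es R c tr

/-- The entry point of an execution: the function that is called, its argument, and the name that it
sees as its caller. -/
structure Entry : Type (u + 1) where
  caller : String
  main : String
  arg : Any.{u}

/-- The initial machine state: it calls the entry point and returns the result. -/
def initConfig (en : Entry.{u}) (Es : List EMS.{u}) : Config.{u} where
  mn := en.caller
  caller := en.caller
  cur := Prog.call en.main en.arg
  stack := []
  mem := initMem Es

/-- The behaviours of a modules code.  Inconsistent loading data and name clashes are undefined
behaviour. -/
def Beh {LD : Type v} [PCM LD] (en : Entry.{u}) (Ms : Mods.{u} LD) : Set Trace.{u} :=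
  {tr | PCM.valid (Ms.map Mod.ld).sum → Linkable (load Ms) →
    (initConfig en (load Ms)).Beh (load Ms) tr}

/-- Contextual refinement. -/
def CtxRefines {LD : Type v} [PCM LD] (Mi Ma : Mods.{u} LD) : Prop :=
  ∀ (en : Entry.{u}) (C : Mods.{u} LD), Beh en (C ++ Mi) ⊆ Beh en (C ++ Ma)

end AL

end

/-!
Strengthening the specifications only affects the calls that an abspec makes: everything else in
`abspec S A σ SA` is built from `abspecCall S` by sequential composition, iteration and
interpretation.  Hence it suffices to have a simulation relation on programs that is adequate for
behaviours, is preserved by these operations, and relates `abspecCall S` to `abspecCall S'`.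

The relation `Sim` is a greatest fixed point whose rounds (`SimStep`) consist of finitely many
one-sided steps followed by a common step or common termination, so that it preserves divergence
(`Diverges.of_sim`).  Two related programs always have the same local state, which is an index of the
relation.  This index is what makes the resource argument possible: the update modality yields a new
resource only for a given frame, and when a call returns, this frame contains the module-local
resource, which is read from the local state.

In a call (`abspecCall_sim`) the left program first makes its choices up to the validity of the
resources; the precondition is then updated with the other three resources as frame
(`RProp.Entails.exists_frame`), and the right program chooses the result.  When the call has
returned, the right program makes all its takes first, and the update of the postcondition provides
what the left program takes.  If the right program finds no pair in its local state, then it has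
undefined behaviour and there is nothing to show.

Congruence (`Sim.bind`, `Sim.iter`, `Sim.interp`) lifts this to function bodies, `ConfigSim.step`
lifts similar functions to machine states with similar stacks and equal memories, and
`Config.Beh.of_sim` is adequacy.
-/

namespace AL

/-! ### Equations for interaction trees -/

namespace ITree

variable {E : PFunctor.{a, b}} {R : Type r} {S : Type t} {T : Type s}

@[simp] theorem observe_ret (x : R) : (ret x : ITree E R).observe = .ret x := rfl

@[simp] theorem observe_tau (t : ITree E R) : (tau t).observe = .tau t := rfl

@[simp] theorem observe_vis (e : E.A) (k : E.B e → ITree E R) :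
    (vis e k).observe = .vis e k := rfl

theorem eq_ret_or_tau_or_vis (x : ITree E R) :
    (∃ y, x = ret y) ∨ (∃ t, x = tau t) ∨ ∃ e k, x = vis e k := by
  have hx : PFunctor.M.mk (PFunctor.M.dest x) = x := PFunctor.M.mk_dest x
  rcases h : PFunctor.M.dest x with ⟨c, k⟩
  rw [h] at hx
  cases c with
  | ret y =>
    refine .inl ⟨y, hx.symm.trans ?_⟩
    exact congrArg PFunctor.M.mk (Sigma.ext rfl (heq_of_eq (funext fun i => i.elim)))
  | tau => exact .inr (.inl ⟨k PUnit.unit, hx.symm⟩)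
  | vis e => exact .inr (.inr ⟨e, k, hx.symm⟩)

/-- Bisimilar trees are equal. -/
theorem eq_of_bisim (B : ITree E R → ITree E R → Prop)
    (hB : ∀ x y, B x y → (∃ z, x = ret z ∧ y = ret z) ∨
      (∃ t t', x = tau t ∧ y = tau t' ∧ B t t') ∨
      ∃ e k k', x = vis e k ∧ y = vis e k' ∧ ∀ z, B (k z) (k' z))
    {x y : ITree E R} (hxy : B x y) : x = y := by
  refine PFunctor.M.bisim B (fun x y h => ?_) x y hxy
  rcases hB x y h with ⟨z, rfl, rfl⟩ | ⟨t, t', rfl, rfl, ht⟩ | ⟨e, k, k', rfl, rfl, hk⟩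
  · exact ⟨.ret z, PEmpty.elim, PEmpty.elim, rfl, rfl, fun i => i.elim⟩
  · exact ⟨.tau, fun _ => t, fun _ => t', rfl, rfl, fun _ => ht⟩
  · exact ⟨.vis e, k, k', rfl, rfl, hk⟩

theorem unfold_ret {f : S → View E R S} {x : S} {y : R} (h : f x = .ret y) :
    unfold f x = ret y := by
  have h' : PFunctor.M.dest (unfold f x) = PFunctor.map _ (unfold f) (f x).toObj :=
    PFunctor.M.dest_corec _ _
  rw [h] at h'
  rw [← PFunctor.M.mk_dest (unfold f x), h']
  exact congrArg PFunctor.M.mk (Sigma.ext rfl (heq_of_eq (funext fun i => i.elim)))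

theorem unfold_tau {f : S → View E R S} {x y : S} (h : f x = .tau y) :
    unfold f x = tau (unfold f y) := by
  have h' : PFunctor.M.dest (unfold f x) = PFunctor.map _ (unfold f) (f x).toObj :=
    PFunctor.M.dest_corec _ _
  rw [h] at h'
  rw [← PFunctor.M.mk_dest (unfold f x), h']
  rfl

theorem unfold_vis {f : S → View E R S} {x : S} {e : E.A} {k : E.B e → S}
    (h : f x = .vis e k) : unfold f x = vis e fun y => unfold f (k y) := by
  have h' : PFunctor.M.dest (unfold f x) = PFunctor.map _ (unfold f) (f x).toObj :=
    PFunctor.M.dest_corec _ _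
  rw [h] at h'
  rw [← PFunctor.M.mk_dest (unfold f x), h']
  rfl

/-- The corecursion step that defines `ITree.bind`. -/
def bindStep (k : R → ITree E S) : ITree E R ⊕ ITree E S → View E S (ITree E R ⊕ ITree E S)
  | .inl y =>
    match y.observe with
    | .ret z => (k z).observe.map .inr
    | .tau y' => .tau (.inl y')
    | .vis e k' => .vis e fun z => .inl (k' z)
  | .inr y => y.observe.map .inr

theorem bind_eq_unfold (x : ITree E R) (k : R → ITree E S) :
    bind x k = unfold (bindStep k) (.inl x) := by
  unfold bind bindStep
  rfl

theorem unfold_bindStep_inr (k : R → ITree E S) (y : ITree E S) :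
    unfold (bindStep k) (.inr y) = y := by
  refine eq_of_bisim (fun x y => x = unfold (bindStep k) (.inr y)) ?_ rfl
  rintro _ y rfl
  rcases eq_ret_or_tau_or_vis y with ⟨z, rfl⟩ | ⟨t, rfl⟩ | ⟨e, k', rfl⟩
  · exact .inl ⟨z, unfold_ret rfl, rfl⟩
  · exact .inr (.inl ⟨_, _, unfold_tau rfl, rfl, rfl⟩)
  · exact .inr (.inr ⟨_, _, _, unfold_vis rfl, rfl, fun _ => rfl⟩)

@[simp] theorem bind_ret (x : R) (k : R → ITree E S) : bind (ret x) k = k x := by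
  rw [bind_eq_unfold]
  rcases eq_ret_or_tau_or_vis (k x) with ⟨z, h⟩ | ⟨t, h⟩ | ⟨e, k', h⟩
  · rw [h]
    exact unfold_ret (by simp [bindStep, h, View.map])
  · rw [unfold_tau (y := .inr t) (by simp [bindStep, h, View.map]), unfold_bindStep_inr, h]
  · rw [unfold_vis (e := e) (k := fun z => .inr (k' z)) (by simp [bindStep, h, View.map]), h]
    simp only [unfold_bindStep_inr]

@[simp] theorem bind_tau (x : ITree E R) (k : R → ITree E S) :
    bind (tau x) k = tau (bind x k) := by
  simp only [bind_eq_unfold]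
  exact unfold_tau rfl

@[simp] theorem bind_vis (e : E.A) (k' : E.B e → ITree E R) (k : R → ITree E S) :
    bind (vis e k') k = vis e fun z => bind (k' z) k := by
  simp only [bind_eq_unfold]
  exact unfold_vis rfl

@[simp] theorem bind_trigger (e : E.A) (k : E.B e → ITree E S) : bind (trigger e) k = vis e k := by
  simp [trigger]

theorem bind_assoc (x : ITree E R) (k : R → ITree E S) (k' : S → ITree E T) :
    bind (bind x k) k' = bind x fun y => bind (k y) k' := by
  refine eq_of_bisim
    (fun y z => y = z ∨ ∃ x : ITree E R, y = bind (bind x k) k' ∧ z = bind x fun y => bind (k y) k')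
    ?_ (.inr ⟨x, rfl, rfl⟩)
  rintro y _ (rfl | ⟨x, rfl, rfl⟩)
  · rcases eq_ret_or_tau_or_vis y with ⟨z, rfl⟩ | ⟨t, rfl⟩ | ⟨e, k', rfl⟩
    · exact .inl ⟨z, rfl, rfl⟩
    · exact .inr (.inl ⟨_, _, rfl, rfl, .inl rfl⟩)
    · exact .inr (.inr ⟨_, _, _, rfl, rfl, fun _ => .inl rfl⟩)
  · rcases eq_ret_or_tau_or_vis x with ⟨z, rfl⟩ | ⟨t, rfl⟩ | ⟨e, k₁, rfl⟩
    · simp only [bind_ret]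
      rcases eq_ret_or_tau_or_vis (bind (k z) k') with ⟨w, h⟩ | ⟨t, h⟩ | ⟨e, k₁, h⟩
      · exact .inl ⟨w, h, h⟩
      · exact .inr (.inl ⟨_, _, h, h, .inl rfl⟩)
      · exact .inr (.inr ⟨_, _, _, h, h, fun _ => .inl rfl⟩)
    · exact .inr (.inl ⟨_, _, by simp only [bind_tau], by simp only [bind_tau], .inr ⟨t, rfl, rfl⟩⟩)
    · exact .inr (.inr ⟨e, _, _, by simp only [bind_vis], by simp only [bind_vis],
        fun z => .inr ⟨k₁ z, rfl, rfl⟩⟩)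

/-- The iteration of `body`, started within an iteration of which `x` remains. -/
def iterFrom (body : S → ITree E (S ⊕ R)) (x : ITree E (S ⊕ R)) : ITree E R :=
  unfold (X := ITree E (S ⊕ R))
    (fun y =>
      match y.observe with
      | .ret (.inl j) => .tau (body j)
      | .ret (.inr x) => .ret x
      | .tau y' => .tau y'
      | .vis e k => .vis e k)
    x

theorem iter_eq_iterFrom (body : S → ITree E (S ⊕ R)) (i : S) :
    iter body i = iterFrom body (body i) := by
  unfold iter iterFrom
  rfl

theorem iterFrom_ret_inl (body : S → ITree E (S ⊕ R)) (j : S) :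
    iterFrom body (ret (.inl j)) = tau (iterFrom body (body j)) :=
  unfold_tau rfl

theorem iterFrom_ret_inr (body : S → ITree E (S ⊕ R)) (x : R) :
    iterFrom body (ret (.inr x)) = ret x :=
  unfold_ret rfl

theorem iterFrom_tau (body : S → ITree E (S ⊕ R)) (x : ITree E (S ⊕ R)) :
    iterFrom body (tau x) = tau (iterFrom body x) :=
  unfold_tau rfl

theorem iterFrom_vis (body : S → ITree E (S ⊕ R)) (e : E.A) (k : E.B e → ITree E (S ⊕ R)) :
    iterFrom body (vis e k) = vis e fun y => iterFrom body (k y) :=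
  unfold_vis rfl

end ITree

open ITree

/-! ### Refinement of programs -/

/-- One round of the simulation game between two programs that run in the same module: the left one
is the implementation, the right one its abstraction, and `st` is the current local state of the
module, which both share.  The constructors `tau` to `getCaller` let both programs make the same
step, and the resulting programs are related by `B`.  By the last six constructors only one of the
programs moves, which is possible only finitely often in one round: choices of the left program and
takes of the right one are made by the opponent, choices of the right program and takes of the left
one are made in favour of the simulation.  As a call may change the local state, the programs have to
be related in every local state after it. -/
inductive SimStep {R : Type r} (B : Any.{u} → ITree EEMS.{u} R → ITree EEMS.{u} R → Prop) :
    Any.{u} → ITree EEMS.{u} R → ITree EEMS.{u} R → Prop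
  | ret {st} (x : R) : SimStep B st (ret x) (ret x)
  | tau {st p q} (h : B st p q) : SimStep B st (tau p) (tau q)
  | choose {st} {X : Type (u + 1)} {k k' : X → ITree EEMS.{u} R} (h : ∀ x, B st (k x) (k' x)) :
      SimStep B st (vis (.choose X) k) (vis (.choose X) k')
  | take {st} {X : Type (u + 1)} {k k' : X → ITree EEMS.{u} R} (h : ∀ x, B st (k x) (k' x)) :
      SimStep B st (vis (.take X) k) (vis (.take X) k')
  | obs {st fn args} {k k' : Any.{u} → ITree EEMS.{u} R} (h : ∀ x, B st (k x) (k' x)) :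
      SimStep B st (vis (.obs fn args) k) (vis (.obs fn args) k')
  | call {st fn args} {k k' : Any.{u} → ITree EEMS.{u} R} (h : ∀ st' x, B st' (k x) (k' x)) :
      SimStep B st (vis (.call fn args) k) (vis (.call fn args) k')
  | get {st} {k k' : Any.{u} → ITree EEMS.{u} R} (h : B st (k st) (k' st)) :
      SimStep B st (vis .get k) (vis .get k')
  | put {st x} {k k' : PUnit.{u + 2} → ITree EEMS.{u} R} (h : B x (k PUnit.unit) (k' PUnit.unit)) :
      SimStep B st (vis (.put x) k) (vis (.put x) k')
  | getCaller {st} {k k' : ULift.{u + 1} String → ITree EEMS.{u} R} (h : ∀ x, B st (k x) (k' x)) :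
      SimStep B st (vis .getCaller k) (vis .getCaller k')
  | chooseLeft {st} {X : Type (u + 1)} {k : X → ITree EEMS.{u} R} {q}
      (h : ∀ x, SimStep B st (k x) q) : SimStep B st (vis (.choose X) k) q
  | chooseRight {st} {X : Type (u + 1)} {p} {k : X → ITree EEMS.{u} R} (x : X)
      (h : SimStep B st p (k x)) : SimStep B st p (vis (.choose X) k)
  | takeLeft {st} {X : Type (u + 1)} {k : X → ITree EEMS.{u} R} {q} (x : X)
      (h : SimStep B st (k x) q) : SimStep B st (vis (.take X) k) q
  | takeRight {st} {X : Type (u + 1)} {p} {k : X → ITree EEMS.{u} R}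
      (h : ∀ x, SimStep B st p (k x)) : SimStep B st p (vis (.take X) k)
  | getLeft {st} {k : Any.{u} → ITree EEMS.{u} R} {q} (h : SimStep B st (k st) q) :
      SimStep B st (vis .get k) q
  | getRight {st p} {k : Any.{u} → ITree EEMS.{u} R} (h : SimStep B st p (k st)) :
      SimStep B st p (vis .get k)

/-- Maps of trees that only replace the leaves preserve a round of the simulation game if they do so
at the leaves. -/
theorem SimStep.map {R : Type r} {T : Type t}
    {B : Any.{u} → ITree EEMS.{u} R → ITree EEMS.{u} R → Prop}
    {B' : Any.{u} → ITree EEMS.{u} T → ITree EEMS.{u} T → Prop}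
    {F G : ITree EEMS.{u} R → ITree EEMS.{u} T}
    (Ftau : ∀ p, F (.tau p) = .tau (F p)) (Fvis : ∀ e k, F (.vis e k) = .vis e fun x => F (k x))
    (Gtau : ∀ p, G (.tau p) = .tau (G p)) (Gvis : ∀ e k, G (.vis e k) = .vis e fun x => G (k x))
    (hret : ∀ st x, SimStep B' st (F (.ret x)) (G (.ret x)))
    (hB : ∀ st p q, B st p q → B' st (F p) (G q)) {st : Any.{u}} {p q : ITree EEMS.{u} R}
    (h : SimStep B st p q) : SimStep B' st (F p) (G q) := by
  induction h with
  | ret x => exact hret _ x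
  | tau h => simpa only [Ftau, Gtau] using .tau (hB _ _ _ h)
  | choose h => simpa only [Fvis, Gvis] using .choose fun x => hB _ _ _ (h x)
  | take h => simpa only [Fvis, Gvis] using .take fun x => hB _ _ _ (h x)
  | obs h => simpa only [Fvis, Gvis] using .obs fun x => hB _ _ _ (h x)
  | call h => simpa only [Fvis, Gvis] using .call fun st x => hB _ _ _ (h st x)
  | get h => simpa only [Fvis, Gvis] using .get (hB _ _ _ h)
  | put h => simpa only [Fvis, Gvis] using .put (hB _ _ _ h)
  | getCaller h => simpa only [Fvis, Gvis] using .getCaller fun x => hB _ _ _ (h x)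
  | chooseLeft _ ih => simpa only [Fvis] using .chooseLeft ih
  | chooseRight x _ ih => simpa only [Gvis] using .chooseRight x ih
  | takeLeft x _ ih => simpa only [Fvis] using .takeLeft x ih
  | takeRight _ ih => simpa only [Gvis] using .takeRight ih
  | getLeft _ ih => simpa only [Fvis] using .getLeft ih
  | getRight _ ih => simpa only [Gvis] using .getRight ih

theorem SimStep.mono {R : Type r} {B B' : Any.{u} → ITree EEMS.{u} R → ITree EEMS.{u} R → Prop}
    (hB : ∀ st p q, B st p q → B' st p q) {st : Any.{u}} {p q : ITree EEMS.{u} R}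
    (h : SimStep B st p q) : SimStep B' st p q :=
  h.map (F := fun p => p) (G := fun p => p) (fun _ => rfl) (fun _ _ => rfl) (fun _ => rfl)
    (fun _ _ => rfl) (fun _ x => .ret x) hB

/-- Simulation: the largest relation `B` with `B ⊆ SimStep B`. -/
def Sim {R : Type r} (st : Any.{u}) (p q : ITree EEMS.{u} R) : Prop :=
  ∃ B : Any.{u} → ITree EEMS.{u} R → ITree EEMS.{u} R → Prop, B st p q ∧
    ∀ st p q, B st p q → SimStep B st p q

namespace Sim

variable {R : Type r} {T : Type t} {st : Any.{u}} {p q : ITree EEMS.{u} R}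

theorem step (h : Sim st p q) : SimStep Sim st p q := by
  obtain ⟨B, hpq, hB⟩ := h
  exact (hB _ _ _ hpq).mono fun _ _ _ h => ⟨B, h, hB⟩

theorem of_step (h : SimStep Sim st p q) : Sim st p q :=
  ⟨SimStep Sim, h, fun _ _ _ h => h.mono fun _ _ _ => step⟩

/-- Coinduction up to simulation. -/
theorem coinduct (B : Any.{u} → ITree EEMS.{u} R → ITree EEMS.{u} R → Prop)
    (hB : ∀ st p q, B st p q → SimStep (fun st p q => B st p q ∨ Sim st p q) st p q)
    (h : B st p q) : Sim st p q := by
  refine ⟨fun st p q => B st p q ∨ Sim st p q, .inl h, ?_⟩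
  rintro st p q (h | h)
  · exact hB _ _ _ h
  · exact h.step.mono fun _ _ _ => .inr

theorem refl (st : Any.{u}) (p : ITree EEMS.{u} R) : Sim st p p := by
  refine ⟨fun _ p q => p = q, rfl, ?_⟩
  rintro st p _ rfl
  rcases eq_ret_or_tau_or_vis p with ⟨x, rfl⟩ | ⟨t, rfl⟩ | ⟨e, k, rfl⟩
  · exact .ret x
  · exact .tau rfl
  · cases e with
    | choose X => exact .choose fun _ => rfl
    | take X => exact .take fun _ => rfl
    | obs fn args => exact .obs fun _ => rfl
    | call fn args => exact .call fun _ _ => rfl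
    | get => exact .get rfl
    | put x => exact .put rfl
    | getCaller => exact .getCaller fun _ => rfl

/-- Sequential composition is monotone.  The continuations have to be related in every local state, as
nothing is known about the one in which the first program returns. -/
theorem bind {k k' : R → ITree EEMS.{u} T} (h : Sim st p q) (hk : ∀ st x, Sim st (k x) (k' x)) :
    Sim st (ITree.bind p k) (ITree.bind q k') := by
  refine coinduct (fun st p' q' => ∃ p q, Sim st p q ∧ p' = ITree.bind p k ∧ q' = ITree.bind q k')
    ?_ ⟨p, q, h, rfl, rfl⟩
  rintro st _ _ ⟨p, q, h, rfl, rfl⟩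
  refine h.step.map (F := fun p => p.bind k) (G := fun q => q.bind k') (fun p => bind_tau p k)
    (fun e k₁ => bind_vis e k₁ k) (fun q => bind_tau q k') (fun e k₁ => bind_vis e k₁ k')
    (fun st x => ?_) fun st p q h => .inl ⟨p, q, h, rfl, rfl⟩
  simp only [bind_ret]
  exact (hk st x).step.mono fun _ _ _ => .inr

theorem bind_right (p : ITree EEMS.{u} R) {k k' : R → ITree EEMS.{u} T}
    (hk : ∀ st x, Sim st (k x) (k' x)) :
    Sim st (ITree.bind p k) (ITree.bind p k') :=
  (refl st p).bind hk

theorem iter {I : Type s} {f f' : I → ITree EEMS.{u} (I ⊕ R)} (hf : ∀ st i, Sim st (f i) (f' i))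
    (i : I) : Sim st (ITree.iter f i) (ITree.iter f' i) := by
  refine coinduct
    (fun st p' q' => ∃ p q, Sim st p q ∧ p' = iterFrom f p ∧ q' = iterFrom f' q)
    ?_ ⟨_, _, hf st i, iter_eq_iterFrom f i, iter_eq_iterFrom f' i⟩
  rintro st _ _ ⟨p, q, h, rfl, rfl⟩
  refine h.step.map (iterFrom_tau f) (iterFrom_vis f) (iterFrom_tau f') (iterFrom_vis f')
    (fun st x => ?_) fun st p q h => .inl ⟨p, q, h, rfl, rfl⟩
  cases x with
  | inl j =>
    simp only [iterFrom_ret_inl]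
    exact .tau (.inl ⟨_, _, hf st j, rfl, rfl⟩)
  | inr x =>
    simp only [iterFrom_ret_inr]
    exact .ret x

/-- Refining the handler of an interpretation refines the interpretation. -/
theorem interp {E : PFunctor.{s, u + 1}} {S : Type t}
    {h h' : (e : E.A) → S → ITree EEMS.{u} (E.B e × S)} (hh : ∀ e s st, Sim st (h e s) (h' e s))
    (x : ITree E R) (s : S) : Sim st (ITree.interp h x s) (ITree.interp h' x s) := by
  refine iter (fun st p => ?_) (x, s)
  obtain ⟨x, s⟩ := p
  rcases eq_ret_or_tau_or_vis x with ⟨y, rfl⟩ | ⟨y, rfl⟩ | ⟨e, k, rfl⟩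
  · exact refl st _
  · exact refl st _
  · exact (hh e s st).bind fun st _ => refl st _

end Sim

/-! ### Simulation of machine states -/

/-- One round of the simulation game between two machine states, the left one executed with the
modules `Es` and the right one with the modules `Es'`; all silent steps are choices from a one-element
type. -/
inductive ConfigSimStep (Es Es' : List EMS.{u}) (B : Config.{u} → Config.{u} → Prop) :
    Config.{u} → Config.{u} → Prop
  | final {c d x} (hc : c.next Es = .final x) (hd : d.next Es' = .final x) :
      ConfigSimStep Es Es' B c d
  | choose {c d X k k'} (hc : c.next Es = .choose X k) (hd : d.next Es' = .choose X k')
      (h : ∀ x, B (k x) (k' x)) : ConfigSimStep Es Es' B c d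
  | take {c d X k k'} (hc : c.next Es = .take X k) (hd : d.next Es' = .take X k')
      (h : ∀ x, B (k x) (k' x)) : ConfigSimStep Es Es' B c d
  | obs {c d fn args k k'} (hc : c.next Es = .obs fn args k) (hd : d.next Es' = .obs fn args k')
      (h : ∀ x, B (k x) (k' x)) : ConfigSimStep Es Es' B c d
  | chooseLeft {c d X k} (hc : c.next Es = .choose X k)
      (h : ∀ x, ConfigSimStep Es Es' B (k x) d) : ConfigSimStep Es Es' B c d
  | chooseRight {c d X k} (hd : d.next Es' = .choose X k) (x : X)
      (h : ConfigSimStep Es Es' B c (k x)) : ConfigSimStep Es Es' B c d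
  | takeLeft {c d X k} (hc : c.next Es = .take X k) (x : X)
      (h : ConfigSimStep Es Es' B (k x) d) : ConfigSimStep Es Es' B c d
  | takeRight {c d X k} (hd : d.next Es' = .take X k)
      (h : ∀ x, ConfigSimStep Es Es' B c (k x)) : ConfigSimStep Es Es' B c d

section Adequacy

variable {Es Es' : List EMS.{u}} {B : Config.{u} → Config.{u} → Prop}

/-- A simulation preserves divergence: in every round both sides make finitely many steps, and at
least one. -/
theorem Diverges.of_sim (hB : ∀ c d, B c d → ConfigSimStep Es Es' B c d) {c d : Config.{u}}
    (h : ConfigSimStep Es Es' B c d) (hc : Diverges Es c) : Diverges Es' d := by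
  obtain ⟨D, hDc, hD⟩ := hc
  refine ⟨fun d => ∃ c, ConfigSimStep Es Es' B c d ∧ D c, ⟨c, h, hDc⟩, ?_⟩
  clear hDc h
  rintro d ⟨c, h, hDc⟩
  induction h with
  | final hc hd =>
    have := hD _ hDc
    rw [hc] at this
    exact this.elim
  | choose hc hd h =>
    have := hD _ hDc
    rw [hc] at this
    obtain ⟨x, hx⟩ := this
    rw [hd]
    exact ⟨x, _, hB _ _ (h x), hx⟩
  | take hc hd h =>
    have := hD _ hDc
    rw [hc] at this
    rw [hd]
    exact fun x => ⟨_, hB _ _ (h x), this x⟩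
  | obs hc hd h =>
    have := hD _ hDc
    rw [hc] at this
    exact this.elim
  | chooseLeft hc h ih =>
    have := hD _ hDc
    rw [hc] at this
    obtain ⟨x, hx⟩ := this
    exact ih x hx
  | chooseRight hd x h ih =>
    rw [hd]
    exact ⟨x, _, h, hDc⟩
  | takeLeft hc x h ih =>
    have := hD _ hDc
    rw [hc] at this
    exact ih (this x)
  | takeRight hd h ih =>
    rw [hd]
    exact fun x => ⟨_, h x, hDc⟩

/-- A simulation preserves traces up to the next observable event: induction on the derivation for
the left state, and within it on the round of the game. -/
theorem BehStep.of_sim (hB : ∀ c d, B c d → ConfigSimStep Es Es' B c d)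
    {P P' : Config.{u} → Trace.{u} → Prop} (hP : ∀ c d tr, B c d → P c tr → P' d tr)
    {c d : Config.{u}} {tr : Trace.{u}} (h : ConfigSimStep Es Es' B c d)
    (hc : BehStep Es P c tr) : BehStep Es' P' d tr := by
  induction hc generalizing d with
  | @term c x hx =>
    induction h with
    | final hc hd =>
      rw [hc] at hx
      cases hx
      exact .term hd
    | choose hc | take hc | obs hc | chooseLeft hc | takeLeft hc =>
      rw [hc] at hx
      cases hx
    | chooseRight hd x _ ih => exact .choose hd x (ih hx)
    | takeRight hd _ ih => exact .take hd fun x => ih x hx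
  | diverge hc => exact .diverge (hc.of_sim hB h)
  | stopped => exact .stopped
  | obs hx x htr =>
    induction h with
    | obs hc hd h =>
      rw [hc] at hx
      cases hx
      exact .obs hd x (hP _ _ _ (h x) htr)
    | final hc | choose hc | take hc | chooseLeft hc | takeLeft hc =>
      rw [hc] at hx
      cases hx
    | chooseRight hd y _ ih => exact .choose hd y (ih hx)
    | takeRight hd _ ih => exact .take hd fun y => ih y hx
  | choose hx x htr ih' =>
    induction h with
    | choose hc hd h =>
      rw [hc] at hx
      cases hx
      exact .choose hd x (ih' (hB _ _ (h x)))
    | chooseLeft hc h =>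
      rw [hc] at hx
      cases hx
      exact ih' (h x)
    | final hc | take hc | obs hc | takeLeft hc =>
      rw [hc] at hx
      cases hx
    | chooseRight hd y _ ih => exact .choose hd y (ih hx)
    | takeRight hd _ ih => exact .take hd fun y => ih y hx
  | take hx htr ih' =>
    induction h with
    | take hc hd h =>
      rw [hc] at hx
      cases hx
      exact .take hd fun x => ih' x (hB _ _ (h x))
    | takeLeft hc x h =>
      rw [hc] at hx
      cases hx
      exact ih' x h
    | final hc | choose hc | obs hc | chooseLeft hc =>
      rw [hc] at hx
      cases hx
    | chooseRight hd y _ ih => exact .choose hd y (ih hx)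
    | takeRight hd _ ih => exact .take hd fun y => ih y hx

/-- Adequacy: similar machine states have the same traces, up to more traces on the right. -/
theorem Config.Beh.of_sim (hB : ∀ c d, B c d → ConfigSimStep Es Es' B c d) {c d : Config.{u}}
    {tr : Trace.{u}} (h : B c d) (hc : c.Beh Es tr) : d.Beh Es' tr := by
  obtain ⟨P, hP, hPstep⟩ := hc
  refine ⟨fun d tr => ∃ c, B c d ∧ P c tr, ⟨c, h, hP⟩, ?_⟩
  rintro d tr ⟨c, h, hc⟩
  exact BehStep.of_sim hB (fun c d tr h hc => ⟨c, h, hc⟩) (hB _ _ h) (hPstep _ _ hc)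

end Adequacy

/-! ### Simulation of modules -/

/-- Functions are similar if their bodies are, for every argument and in every local state. -/
def FundefSim (f g : Fundef EEMS.{u}) : Prop := ∀ st x, Sim st (f x) (g x)

/-- Suspended functions are similar if their remainders are, for every answer and in every local
state. -/
structure FrameSim (f g : Frame.{u}) : Prop where
  mn : f.mn = g.mn
  caller : f.caller = g.caller
  k : FundefSim f.k g.k

/-- Machine states are similar if they have the same local states and similar running and suspended
functions. -/
inductive ConfigSim : Config.{u} → Config.{u} → Prop
  | intro {mn caller p q fs gs mem} (h : Sim (mem mn) p q) (hs : List.Forall₂ FrameSim fs gs) :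
      ConfigSim ⟨mn, caller, p, fs, mem⟩ ⟨mn, caller, q, gs, mem⟩

/-- Modules are similar if they have the same name, initial local state and function names, and
similar functions. -/
structure EMSSim (E E' : EMS.{u}) : Prop where
  name : E.name = E'.name
  init : E.init = E'.init
  funs : ∀ fn, Option.Rel FundefSim (E.funs.get fn) (E'.funs.get fn)

theorem FundefSim.refl (f : Fundef EEMS.{u}) : FundefSim f f := fun st x => Sim.refl st (f x)

theorem EMSSim.refl (E : EMS.{u}) : EMSSim E E where
  name := rfl
  init := rfl
  funs fn := by
    cases E.funs.get fn with
    | none => exact .none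
    | some f => exact .some (.refl f)

theorem lookup_sim {Es Es' : List EMS.{u}} (h : List.Forall₂ EMSSim Es Es') (fn : String) :
    Option.Rel (fun p q => p.1 = q.1 ∧ FundefSim p.2 q.2) (lookup Es fn) (lookup Es' fn) := by
  induction h with
  | nil => exact .none
  | @cons E E' Es Es' hE _ ih =>
    have hf := hE.funs fn
    unfold lookup at ih ⊢
    rw [List.findSome?_cons, List.findSome?_cons]
    generalize E.funs.get fn = f at hf
    generalize E'.funs.get fn = g at hf
    cases hf with
    | none => exact ih
    | some h => exact .some ⟨hE.name, h⟩

theorem initMem_eq {Es Es' : List EMS.{u}} (h : List.Forall₂ EMSSim Es Es') :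
    initMem Es = initMem Es' := by
  funext mn
  induction h with
  | nil => rfl
  | @cons E E' Es Es' hE _ ih =>
    unfold initMem at ih ⊢
    rw [List.find?_cons, List.find?_cons, ← hE.name]
    cases E.name == mn with
    | true => exact hE.init
    | false => exact ih

theorem EMSSim.get_eq_none_iff {E E' : EMS.{u}} (h : EMSSim E E') (fn : String) :
    E.funs.get fn = none ↔ E'.funs.get fn = none := by
  have hf := h.funs fn
  generalize E.funs.get fn = f at hf
  generalize E'.funs.get fn = g at hf
  cases hf <;> simp

theorem linkable_of_sim {Es Es' : List EMS.{u}} (h : List.Forall₂ EMSSim Es Es')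
    (hl : Linkable Es') : Linkable Es := by
  unfold Linkable at hl ⊢
  induction h with
  | nil => exact .nil
  | @cons E E' Es Es' hE hEs ih =>
    rw [List.pairwise_cons] at hl ⊢
    refine ⟨fun F hF => ?_, ih hl.2⟩
    obtain ⟨F', hF', hFF'⟩ : ∃ F' ∈ Es', EMSSim F F' := by
      clear ih hl
      induction hEs with
      | nil => cases hF
      | cons h _ ih =>
        rcases List.mem_cons.1 hF with rfl | hF
        · exact ⟨_, List.mem_cons_self, h⟩
        · obtain ⟨F', hF', hFF'⟩ := ih hF
          exact ⟨F', List.mem_cons_of_mem _ hF', hFF'⟩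
    have := hl.1 F' hF'
    rw [hE.name, hFF'.name]
    exact ⟨this.1, fun fn => by rw [hE.get_eq_none_iff, hFF'.get_eq_none_iff]; exact this.2 fn⟩

/-- Executed with similar modules, similar machine states can play the next round. -/
theorem ConfigSim.step {Es Es' : List EMS.{u}} (hE : List.Forall₂ EMSSim Es Es')
    {c d : Config.{u}} (h : ConfigSim c d) : ConfigSimStep Es Es' ConfigSim c d := by
  obtain ⟨h, hs⟩ := h
  rename_i mn caller p q fs gs mem
  replace h := h.step
  generalize hst : mem mn = st at h
  induction h with
  | ret x =>
    cases hs with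
    | nil => exact .final (x := x) rfl rfl
    | @cons f g fs gs hf hs =>
      obtain ⟨mn₁, caller₁, k⟩ := f
      obtain ⟨mn₂, caller₂, k'⟩ := g
      obtain ⟨h₁, h₂, hk⟩ := hf
      subst h₁ h₂
      exact .choose rfl rfl fun _ => .intro (hk _ x) hs
  | tau h =>
    subst hst
    exact .choose rfl rfl fun _ => .intro h hs
  | choose h =>
    subst hst
    exact .choose rfl rfl fun x => .intro (h x) hs
  | take h =>
    subst hst
    exact .take rfl rfl fun x => .intro (h x) hs
  | obs h =>
    subst hst
    exact .obs rfl rfl fun x => .intro (h x) hs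
  | @call fn args k k' h =>
    have hl := lookup_sim hE fn
    rcases hf : lookup Es fn with _ | ⟨mn₁, f⟩ <;> rcases hg : lookup Es' fn with _ | ⟨mn₂, g⟩ <;>
      rw [hf, hg] at hl <;> cases hl
    · refine .take (X := PEmpty) (k := fun x => x.elim) (k' := fun x => x.elim) ?_ ?_
        fun x => x.elim
      · simp [Config.next, hf]
      · simp [Config.next, hg]
    · rename_i hfg
      obtain ⟨h₁, hfg⟩ := hfg
      cases h₁
      refine .choose (X := PUnit) (k := fun _ => ⟨mn₁, mn, f args, ⟨mn, caller, k⟩ :: fs, mem⟩)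
        (k' := fun _ => ⟨mn₁, mn, g args, ⟨mn, caller, k'⟩ :: gs, mem⟩) ?_ ?_
        fun _ => .intro (hfg _ args) (.cons ⟨rfl, rfl, h⟩ hs)
      · simp [Config.next, hf, Next.silent]
      · simp [Config.next, hg, Next.silent]
  | get h =>
    subst hst
    exact .choose rfl rfl fun _ => .intro h hs
  | @put x k k' h =>
    refine .choose (X := PUnit) (k := fun _ => ⟨mn, caller, k .unit, fs, Function.update mem mn x⟩)
      (k' := fun _ => ⟨mn, caller, k' .unit, gs, Function.update mem mn x⟩) rfl rfl
      fun _ => .intro ?_ hs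
    rwa [Function.update_self]
  | getCaller h =>
    subst hst
    exact .choose rfl rfl fun _ => .intro (h _) hs
  | chooseLeft _ ih => exact .chooseLeft rfl ih
  | chooseRight x _ ih => exact .chooseRight rfl x ih
  | takeLeft x _ ih => exact .takeLeft rfl x ih
  | takeRight _ ih => exact .takeRight rfl ih
  | getLeft _ ih =>
    subst hst
    exact .chooseLeft rfl fun _ => ih
  | getRight _ ih =>
    subst hst
    exact .chooseRight rfl PUnit.unit ih

/-- Similarity of the semantics of a module code, for all loading data, is contextual refinement. -/
theorem ctxRefines_of_sim {LD : Type v} [PCM LD] (ld : LD) {E E' : LD → EMS.{u}}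
    (h : ∀ L, EMSSim (E L) (E' L)) : CtxRefines [⟨ld, E⟩] [⟨ld, E'⟩] := by
  intro en C tr htr hv hl
  have hsum : ((C ++ [Mod.mk ld E]).map Mod.ld).sum = ((C ++ [Mod.mk ld E']).map Mod.ld).sum := by
    simp
  have hE : List.Forall₂ EMSSim (load (C ++ [Mod.mk ld E])) (load (C ++ [Mod.mk ld E'])) := by
    unfold load
    rw [hsum]
    generalize ((C ++ [Mod.mk ld E']).map Mod.ld).sum = L
    clear htr hv hl hsum
    induction C with
    | nil => exact .cons (h L) .nil
    | cons m C ih => exact .cons (.refl _) ih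
  refine (htr (hsum ▸ hv) (linkable_of_sim hE hl)).of_sim (fun c d => ConfigSim.step hE) ?_
  unfold initConfig
  rw [initMem_eq hE]
  exact .intro (Sim.refl _ _) .nil

/-! ### Strengthening specifications in calls -/

namespace Sim

section OneSided

variable {R : Type r} {st : Any.{u}} {X : Type (u + 1)} {p q : ITree EEMS.{u} R}

theorem chooseLeft {k : X → ITree EEMS.{u} R} (h : ∀ x, Sim st (k x) q) :
    Sim st (vis (.choose X) k) q :=
  of_step (.chooseLeft fun x => (h x).step)

theorem chooseRight {k : X → ITree EEMS.{u} R} (x : X) (h : Sim st p (k x)) :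
    Sim st p (vis (.choose X) k) :=
  of_step (.chooseRight x h.step)

theorem takeLeft {k : X → ITree EEMS.{u} R} (x : X) (h : Sim st (k x) q) :
    Sim st (vis (.take X) k) q :=
  of_step (.takeLeft x h.step)

theorem takeRight {k : X → ITree EEMS.{u} R} (h : ∀ x, Sim st p (k x)) :
    Sim st p (vis (.take X) k) :=
  of_step (.takeRight fun x => (h x).step)

theorem getLeft {k : Any.{u} → ITree EEMS.{u} R} (h : Sim st (k st) q) : Sim st (vis .get k) q :=
  of_step (.getLeft h.step)

theorem getRight {k : Any.{u} → ITree EEMS.{u} R} (h : Sim st p (k st)) : Sim st p (vis .get k) :=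
  of_step (.getRight h.step)

end OneSided

end Sim

namespace Prog

variable {R : Type (u + 1)} {T : Type r} {M : Type u}

theorem bind_def {R' : Type (u + 1)} (p : Prog.{u} R) (k : R → Prog.{u} R') :
    p >>= k = ITree.bind p k := rfl

theorem pure_def (x : R) : (pure x : Prog.{u} R) = ITree.ret x := rfl

theorem bind_choose {X : Type (u + 1)} (k : X → ITree EEMS.{u} T) :
    ITree.bind (choose X) k = vis (E := EEMS.{u}) (.choose X) k :=
  bind_trigger (E := EEMS.{u}) (.choose X) k

theorem bind_take {X : Type (u + 1)} (k : X → ITree EEMS.{u} T) :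
    ITree.bind (take X) k = vis (E := EEMS.{u}) (.take X) k :=
  bind_trigger (E := EEMS.{u}) (.take X) k

theorem bind_get (k : Any.{u} → ITree EEMS.{u} T) : ITree.bind get k = vis (E := EEMS.{u}) .get k :=
  bind_trigger (E := EEMS.{u}) .get k

theorem bind_guarantee (φ : Prop) (k : PUnit.{u + 2} → ITree EEMS.{u} T) :
    ITree.bind (guarantee φ) k =
      vis (E := EEMS.{u}) (.choose (ULift.{u + 1} (PLift φ))) fun _ => k .unit := by
  simp only [guarantee, bind_def, pure_def, ITree.bind_assoc, bind_ret]
  exact bind_choose _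

theorem bind_assume (φ : Prop) (k : PUnit.{u + 2} → ITree EEMS.{u} T) :
    ITree.bind (assume φ) k =
      vis (E := EEMS.{u}) (.take (ULift.{u + 1} (PLift φ))) fun _ => k .unit := by
  simp only [assume, bind_def, pure_def, ITree.bind_assoc, bind_ret]
  exact bind_take _

end Prog

theorem Any.eq_up_of_down_eq_some {T : Type u} {x : Any.{u}} {y : T} (h : x.down T = some y) :
    x = .up T y := by
  cases x with
  | pair x x' => cases h
  | up T' x =>
    simp only [Any.down] at h
    split_ifs at h with hT
    · subst hT
      cases h
      rfl

@[simp] theorem Any.down_up {T : Type u} (y : T) : (Any.up T y).down T = some y := by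
  simp [Any.down]

namespace Sim

variable {R : Type r} {st : Any.{u}} {p q : ITree EEMS.{u} R} {φ : Prop} {M : Type u}

theorem guaranteeLeft {k : PUnit.{u + 2} → ITree EEMS.{u} R} (h : φ → Sim st (k .unit) q) :
    Sim st (ITree.bind (Prog.guarantee φ) k) q := by
  rw [Prog.bind_guarantee]
  exact chooseLeft fun x => h x.down.down

theorem guaranteeRight {k : PUnit.{u + 2} → ITree EEMS.{u} R} (hφ : φ)
    (h : Sim st p (k .unit)) : Sim st p (ITree.bind (Prog.guarantee φ) k) := by
  rw [Prog.bind_guarantee]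
  exact chooseRight ⟨⟨hφ⟩⟩ h

theorem assumeLeft {k : PUnit.{u + 2} → ITree EEMS.{u} R} (hφ : φ)
    (h : Sim st (k .unit) q) : Sim st (ITree.bind (Prog.assume φ) k) q := by
  rw [Prog.bind_assume]
  exact takeLeft ⟨⟨hφ⟩⟩ h

theorem assumeRight {k : PUnit.{u + 2} → ITree EEMS.{u} R} (h : φ → Sim st p (k .unit)) :
    Sim st p (ITree.bind (Prog.assume φ) k) := by
  rw [Prog.bind_assume]
  exact takeRight fun x => h x.down.down

/-- If the local state is not a pair with a resource, then the right program has undefined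
behaviour. -/
theorem getPairRight {k : Any.{u} × M → ITree EEMS.{u} R}
    (h : ∀ x m, st = .pair x (.up M m) → Sim st p (k (x, m))) :
    Sim st p (ITree.bind (getPair M) k) := by
  have hub : Sim st p (ITree.bind Prog.ub k) := by
    rw [Prog.ub, ITree.bind_assoc, Prog.bind_take]
    exact takeRight fun x => x.elim
  simp only [getPair, Prog.bind_def, ITree.bind_assoc]
  rw [Prog.bind_get]
  refine getRight ?_
  cases st with
  | up T x => exact hub
  | pair x y =>
    dsimp only
    cases hy : y.down M with
    | none => exact hub
    | some m =>
      simp only [Prog.pure_def, bind_ret]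
      exact h x m (by rw [Any.eq_up_of_down_eq_some hy])

theorem getPairLeft {k : Any.{u} × M → ITree EEMS.{u} R} {x : Any.{u}} {m : M}
    (h : Sim (.pair x (.up M m)) (k (x, m)) q) :
    Sim (.pair x (.up M m)) (ITree.bind (getPair M) k) q := by
  simp only [getPair, Prog.bind_def, ITree.bind_assoc]
  rw [Prog.bind_get]
  refine getLeft ?_
  simpa only [Any.down_up, Prog.pure_def, bind_ret] using h

end Sim

section Strengthening

variable {M : Type u} [PCM M] {S S' : Specs M}

/-- An update inside a larger valid resource. -/
theorem RProp.Entails.exists_frame {P Q : RProp M} (h : P.Entails Q.upd) {x y : M}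
    (hx : P x) (hv : PCM.valid (x + y)) : ∃ x', PCM.valid (x' + y) ∧ Q x' :=
  h x (PCM.valid_of_add _ _ hv) hx y hv

/-- The heart of the argument: a call according to stronger specifications abstracts a call according
to weaker ones.  Both calls use the same values, measure, function-local, module-local and frame
resources; only the resource that satisfies the condition is exchanged, by the update of the
precondition when the call is made and by that of the postcondition when it returns. -/
theorem abspecCall_sim (h : S'.Stronger S) (d : Measure.{u}) (frm : M) (fn : String)
    (xa st : Any.{u}) : Sim st (abspecCall S d frm fn xa) (abspecCall S' d frm fn xa) := by
  unfold abspecCall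
  cases hs : S.get fn with
  | none =>
    -- Here the left program has no behaviour, whatever the right one does.
    simp only [Prog.nb, Prog.bind_choose]
    exact .chooseLeft fun x => x.elim
  | some s =>
    obtain ⟨s', hs', hss'⟩ := h fn s hs
    simp only [hs', GUARANTEE, ASSUME, Prog.bind_def, Prog.pure_def, ITree.bind_assoc, bind_ret]
    simp only [Prog.bind_choose, Prog.bind_take]
    -- The right program makes its first choice only after the guarantees of the left one, as `res'` can
    -- be found only once the precondition and the validity of the resources are known.
    refine .chooseLeft fun c => ?_
    obtain ⟨c', hpre, hpost⟩ := hss' c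
    refine .chooseLeft fun ⟨x, d', res, resf, resm⟩ => .guaranteeLeft fun hres =>
      .guaranteeLeft fun hv => ?_
    obtain ⟨res', hv', hres'⟩ := (hpre x xa d').exists_frame hres
      (y := resf + resm + frm) (by simpa only [add_assoc] using hv)
    refine .chooseRight c' (.chooseRight (x, d', res', resf, resm) (.guaranteeRight hres'
      (.guaranteeRight (by simpa only [add_assoc] using hv') (.bind_right _ fun st p =>
        .bind_right _ fun st _ => .bind_right _ fun st _ => .bind_right _ fun st y => ?_))))
    -- After the call the left program waits instead, and what it takes depends on the module-local
    -- resource `m`; so the right program reads the local state first.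
    refine .takeRight fun ⟨ya, d'', res, frm'⟩ => .getPairRight fun z m hst =>
      .assumeRight fun hres => .assumeRight fun hv => ?_
    subst hst
    obtain ⟨res', hv', hres'⟩ := (hpost y ya).exists_frame hres
      (y := resf + m + frm') (by simpa only [add_assoc] using hv)
    exact .takeLeft (ya, d'', res', frm') (.getPairLeft (.assumeLeft hres'
      (.assumeLeft (by simpa only [add_assoc] using hv') (.refl _ _))))

theorem abspecIPC_sim (h : S'.Stronger S) (d : Measure.{u}) (frm : M) (st : Any.{u}) :
    Sim st (abspecIPC S d frm) (abspecIPC S' d frm) := by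
  refine .bind_right _ fun st i => .iter (fun st p => ?_) (i, frm)
  obtain ⟨i, frm⟩ := p
  refine .bind_right _ fun st go => ?_
  dsimp only
  split
  · exact .bind_right _ fun st q => .bind (abspecCall_sim h d frm q.1 q.2 st) fun st _ => .refl _ _
  · exact .refl _ _

theorem abspecHandler_sim (h : S'.Stronger S) (d : Measure.{u}) (e : EPAbs.{u}.A) (frm : M)
    (st : Any.{u}) : Sim st (abspecHandler S d e frm) (abspecHandler S' d e frm) := by
  rcases e with (X | X | ⟨fn, args⟩ | ⟨fn, args⟩ | _ | x | _) | _
  case ems.call => exact abspecCall_sim h d frm fn args st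
  case ipc => exact abspecIPC_sim h d frm st
  all_goals exact .refl _ _

theorem abspecFun_sim (h : S'.Stronger S) (s : Spec M) (f : Fundef EPAbs.{u}) (st x : Any.{u}) :
    Sim st (abspecFun S s f x) (abspecFun S' s f x) := by
  refine .bind_right _ fun st c => .bind_right _ fun st ⟨xa, d, frm⟩ => ?_
  cases d with
  | none => exact .bind (.interp (abspecHandler_sim h none) (f xa) frm) fun _ _ => .refl _ _
  | some o => exact .bind (abspecIPC_sim h (some o) frm st) fun _ _ => .refl _ _

theorem toAbspec_sim (h : S'.Stronger S) (f : Fundef EPAbs.{u} × Fundef EPAbs.{u}) (s : Spec M)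
    (st x : Any.{u}) : Sim st (toAbspec S f s x) (toAbspec S' f s x) := by
  refine .bind_right _ fun st isFriend => ?_
  split
  · exact abspecFun_sim h s f.1 st x
  · exact abspecFun_sim h (Spec.star M) f.2 st x

theorem abspec_sim (h : S'.Stronger S) (A : PAbs.{u}) (σ : M) (SA : Specs M) :
    EMSSim (abspec S A σ SA) (abspec S' A σ SA) where
  name := rfl
  init := rfl
  funs fn := by
    simp only [abspec, FinPMap.zipWith]
    split
    · exact .some (toAbspec_sim h _ _)
    · exact .none

end Strengthening

end AL

theorem theorem4p2 {M : Type u} [AL.PCM M] {LD : Type v} [AL.PCM LD] (ld : LD)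
    (S S' : LD → AL.Specs M) (A : LD → AL.PAbs.{u}) (σ : LD → M) (SA : LD → AL.Specs M)
    (h : ∀ L, (S' L).Stronger (S L)) :
    AL.CtxRefines
      [⟨ld, fun L => AL.abspec (S L) (A L) (σ L) (SA L)⟩]
      [⟨ld, fun L => AL.abspec (S' L) (A L) (σ L) (SA L)⟩] :=
  AL.ctxRefines_of_sim ld fun L => AL.abspec_sim (h L) (A L) (σ L) (SA L)
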